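/- Lemma 6.1 (Positivity). For complex $s,\beta$ let $l(s)=\pi^{-s/2}\cdot 2\Gamma(1+s/2)$ and $b(s,\beta)=\sin(\pi s/4)\,l(2\beta+s)\,(2\beta+s-1)$. Let $(x)_n=x(x+1)\cdots(x+n-1)$, and for an integer $w\ge 0$ put $$T_0(z,\beta,4w)=\frac{(-1)^{w+1}}{\pi^{1-\beta}\Gamma(1+\beta)}\sum_{k\ge w+1}\frac{(\pi z)^{2k}}{(1+\beta)_{2k}\,(2k+\beta-\tfrac12)},$$ $$P_{4w}(z,\beta)=\frac{(-1)^{w+1}}{\pi^{1-\beta}\Gamma(1+\beta)}\sum_{k\ge w+1}\frac{(-1)^k z^{2k}}{(1+\beta)_{2k}\,(2k+\beta-\tfrac12)\,\zeta(2\beta+4k)}.$$ Let $\beta\ge 0$ be real and let $w\ge 0$ be an integer. Both series converge absolutely for every complex $z$, and the following hold. (0) $T_0$ is the Mellin density of $(-1)^w/b(s,\beta)$: if $\max\{4w,\,1-2\beta\}<\operatorname{Re}(s)<4(w+1)$, then $$\frac{(-1)^w}{b(s,\beta)}=\int_0^\infty v^{s-1}\,T_0(i v^{-2},\beta,4w)\,dv,$$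 with an absolutely convergent integral. (1) If $P_{4w}(r,\beta)$ is positive for all $r>0$, then $T_0(ir,\beta,4w)$ is positive for all $r>0$. (2) $T_0(ir,\beta,4w)$ is positive for all $r>0$. (3) For all $r>0$, $$T_0(ir,\beta,4w)=\sum_{n\ge1}n^{-2\beta}\,P_{4w}(\pi r/n^2,\beta),$$ and the series converges absolutely. -/

import Mathlib

open scoped ComplexOrder

namespace ZetaMellin

noncomputable section

/-- `l(s) = π^{-s/2} · 2 Γ(1 + s/2)`, which is `π^{-s/2} s Γ(s/2)` with the removable singularity
at `s = 0` filled in. -/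
def l (s : ℂ) : ℂ := (Real.pi : ℂ) ^ (-s / 2) * (2 * Complex.Gamma (1 + s / 2))

/-- `n₀(s, β) = sin(πs/4) l(2β + s)`. -/
def n0 (s β : ℂ) : ℂ := Complex.sin (Real.pi * s / 4) * l (2 * β + s)

/-- `b(s, β) = n₀(s, β) (2β + s - 1)`. -/
def b (s β : ℂ) : ℂ := n0 s β * (2 * β + s - 1)

/-- The Pochhammer symbol `(z)_n = z (z + 1) ⋯ (z + n - 1)`. -/
def poch (z : ℂ) (n : ℕ) : ℂ := ∏ k ∈ Finset.range n, (z + k)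

/-- The term of index `k` in the series of `T₀(z, β, 4w)`. -/
def T0Term (z β : ℂ) (k : ℕ) : ℂ :=
  (Real.pi * z) ^ (2 * k) / (poch (1 + β) (2 * k) * (2 * k + β - 1 / 2))

/-- `T₀(z, β, 4w)`; the argument `w` stands for `4w`, and the sum runs over `k = j + (w + 1)`,
that is over all `k ≥ w + 1`. -/
def T0 (z β : ℂ) (w : ℕ) : ℂ :=
  (-1) ^ (w + 1) / ((Real.pi : ℂ) ^ (1 - β) * Complex.Gamma (1 + β)) *
    ∑' j : ℕ, T0Term z β (j + (w + 1))

/-- The term of index `k` in the series of `P_{4w}(z, β)`. -/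
def PTerm (z β : ℂ) (k : ℕ) : ℂ :=
  (-1) ^ k * z ^ (2 * k) /
    (poch (1 + β) (2 * k) * (2 * k + β - 1 / 2) * riemannZeta (2 * β + 4 * k))

/-- `P_{4w}(z, β)`; the sum runs over all `k ≥ w + 1`. -/
def P (w : ℕ) (z β : ℂ) : ℂ :=
  (-1) ^ (w + 1) / ((Real.pi : ℂ) ^ (1 - β) * Complex.Gamma (1 + β)) *
    ∑' j : ℕ, PTerm z β (j + (w + 1))

end

end ZetaMellin

/-! On the imaginary axis the factor i^(2k) = (-1)^k absorbs the sign in front of `T0`, and Γ(1+β)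
completes the Pochhammer symbol. This leaves T₀(ir) = π^(β-1) F(πr) with F(x) = ∑ (-1)^j x^(2k) /
(Γ(β+2k+1)(2k+β-1/2)), k = j+w+1. This F comes from 1 - cos x ≥ 0 by averaging twice against
positive weights. The weight (1-y)^(2w+β-1), followed by multiplication by x^(2w)/Γ(2w+β), turns the
factorials into Γ(β+2k+1) (`exists_lommel`); the weight y^(β-3/2) then produces 1/(2k+β-1/2)
(`exists_lommel_average`). Hence F > 0, with no use of P. The same construction gives the Mellin
transform: each average multiplies it by a Beta integral (`HasMellin.eulerTransform`), and that of 1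
- cos is explicit (`hasMellin_one_sub_cos`). The substitution x = πv⁻² then gives the density of
(-1)^w/b. The expansion in P is an interchange of sums: ∑ n^(-2β-4k) = ζ(2β+4k) cancels the zeta
value in the denominator (`hasSum_T0_of_P`). Positivity of P therefore passes to T₀ term by term. -/

open MeasureTheory Set

/-! ### Calculus of Mellin transforms -/

/-- Mellin transforms turn multiplicative superpositions `∫ W y * f (x * y) dy` into products. -/
theorem HasMellin.superposition {f W : ℝ → ℂ} {s F G : ℂ} (hfm : Measurable f)
    (hWm : Measurable W) (hf : HasMellin f s F) (hW : HasMellin W (1 - s) G) :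
    HasMellin (fun x => ∫ y in Ioi (0 : ℝ), W y * f (x * y)) s (F * G) := by
  set φ : ℝ → ℂ := fun t => (t : ℂ) ^ (s - 1) • f t with hφ
  set ψ : ℝ → ℂ := fun t => (t : ℂ) ^ (1 - s - 1) • W t with hψ
  have hφi : IntegrableOn φ (Ioi 0) := hf.1
  have hψi : IntegrableOn ψ (Ioi 0) := hW.1
  set Φ : ℝ → ℝ → ℂ := fun x y => (x : ℂ) ^ (s - 1) * (W y * f (x * y)) with hΦ
  -- Since y · y^(-s) · y^(s-1) = 1, the double integrand is yψ(y)φ(xy). Scaling x by y cancels the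
  -- factor y, so both the norm integral and the integral itself split into products.
  have key : ∀ y ∈ Ioi (0 : ℝ), ∀ x ∈ Ioi (0 : ℝ), Φ x y = (y * ψ y) * φ (x * y) := by
    intro y hy x hx
    have hy0 : (y : ℂ) ≠ 0 := Complex.ofReal_ne_zero.2 (ne_of_gt hy)
    have e1 : (y : ℂ) * (y : ℂ) ^ (1 - s - 1) * (y : ℂ) ^ (s - 1) = 1 := by
      nth_rewrite 1 [← Complex.cpow_one (y : ℂ)]
      rw [← Complex.cpow_add _ _ hy0, ← Complex.cpow_add _ _ hy0]
      ring_nf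
      exact Complex.cpow_zero _
    simp only [hΦ, hψ, hφ, smul_eq_mul, Complex.ofReal_mul]
    rw [Complex.mul_cpow_ofReal_nonneg (le_of_lt hx) (le_of_lt hy)]
    linear_combination (- (x : ℂ) ^ (s - 1) * (W y * f (x * y))) * e1
  have hmeas : Measurable (Function.uncurry Φ) := by
    simp only [hΦ, Function.uncurry_def]
    fun_prop
  have hint1 : ∀ y ∈ Ioi (0 : ℝ), IntegrableOn (fun x => Φ x y) (Ioi 0) := by
    intro y hy
    refine IntegrableOn.congr_fun (f := fun x => (y * ψ y) * φ (x * y)) ?_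
      (fun x hx => (key y hy x hx).symm) measurableSet_Ioi
    refine Integrable.const_mul ?_ _
    have := (integrableOn_Ioi_comp_mul_right_iff φ 0 hy).2 (by simpa using hφi)
    exact this
  have hint2 : Integrable (Function.uncurry Φ)
      ((volume.restrict (Ioi 0)).prod (volume.restrict (Ioi 0))) := by
    rw [integrable_prod_iff' hmeas.aestronglyMeasurable]
    constructor
    · exact (ae_restrict_iff' measurableSet_Ioi).2 (ae_of_all _ hint1)
    · have h3 : IntegrableOn (fun y => ‖ψ y‖ * ∫ x in Ioi (0 : ℝ), ‖φ x‖) (Ioi 0) :=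
        hψi.norm.mul_const _
      refine IntegrableOn.congr_fun h3 (fun y hy => ?_) measurableSet_Ioi
      have hy' : (0 : ℝ) < y := hy
      simp only [Function.uncurry_apply_pair]
      rw [setIntegral_congr_fun (f := fun x => ‖Φ x y‖)
        (g := fun x => ‖(y : ℂ) * ψ y‖ * ‖φ (x * y)‖) measurableSet_Ioi
        (fun x hx => by simp only [key y hy x hx, norm_mul]),
        integral_const_mul, integral_comp_mul_right_Ioi (fun x => ‖φ x‖) 0 hy', norm_mul,
        Complex.norm_real, Real.norm_of_nonneg hy'.le, zero_mul, smul_eq_mul]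
      field_simp
  constructor
  · have h := hint2.integral_prod_left
    refine h.congr ?_
    refine ae_of_all _ fun x => ?_
    simp only [Function.uncurry_apply_pair, hΦ, smul_eq_mul]
    rw [integral_const_mul]
  · have h := integral_integral_swap hint2
    have e1 : mellin (fun x => ∫ y in Ioi (0 : ℝ), W y * f (x * y)) s
        = ∫ x in Ioi (0 : ℝ), ∫ y in Ioi (0 : ℝ), Φ x y := by
      simp only [mellin, hΦ, integral_const_mul, smul_eq_mul]
    rw [e1, h, ← hf.2, ← hW.2, mellin, mellin, ← integral_const_mul]
    refine setIntegral_congr_fun measurableSet_Ioi fun y hy => ?_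
    have hy' : (0 : ℝ) < y := hy
    have hy0 : (y : ℂ) ≠ 0 := Complex.ofReal_ne_zero.2 (ne_of_gt hy)
    rw [setIntegral_congr_fun measurableSet_Ioi (fun x hx => key y hy x hx),
        integral_const_mul, integral_comp_mul_right_Ioi φ 0 hy']
    simp only [zero_mul, Complex.real_smul, Complex.ofReal_inv]
    field_simp
    exact mul_comm _ _

theorem HasMellin.congr_Ioi {f g : ℝ → ℂ} {s m : ℂ} (hf : HasMellin f s m)
    (h : ∀ x, 0 < x → f x = g x) : HasMellin g s m := by
  constructor
  · refine IntegrableOn.congr_fun hf.1 (fun x hx => ?_) measurableSet_Ioi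
    simp only [h x hx]
  · rw [← hf.2]
    refine setIntegral_congr_fun measurableSet_Ioi (fun x hx => ?_)
    simp only [h x hx]

theorem HasMellin.comp_rpow {f : ℝ → ℂ} {s m : ℂ} {a : ℝ} (ha : a ≠ 0)
    (h : HasMellin f (s / a) m) : HasMellin (fun x => f (x ^ a)) s (|a|⁻¹ * m) := by
  refine ⟨(MellinConvergent.comp_rpow ha).2 h.1, ?_⟩
  rw [mellin_comp_rpow, h.2]
  simp

theorem HasMellin.comp_mul_left {f : ℝ → ℂ} {s m : ℂ} {a : ℝ} (ha : 0 < a)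
    (h : HasMellin f s m) : HasMellin (fun x => f (a * x)) s ((a : ℂ) ^ (-s) * m) := by
  refine ⟨(MellinConvergent.comp_mul_left ha).2 h.1, ?_⟩
  rw [mellin_comp_mul_left _ _ ha, h.2, smul_eq_mul]

theorem HasMellin.cpow_mul {f : ℝ → ℂ} {s m : ℂ} {a : ℂ}
    (h : HasMellin f (s + a) m) : HasMellin (fun x => (x : ℂ) ^ a * f x) s m :=
  ⟨MellinConvergent.cpow_smul.2 h.1, (mellin_cpow_smul f s a).trans h.2⟩

theorem HasMellin.const_mul {f : ℝ → ℂ} {s m : ℂ} (c : ℂ)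
    (h : HasMellin f s m) : HasMellin (fun x => c * f x) s (c * m) :=
  ⟨h.1.const_smul c, by rw [← h.2]; exact mellin_const_smul f s c⟩

/-! ### The Mellin transform of 1 - cos -/

theorem hasMellin_exp_neg {s : ℂ} (hs : 0 < s.re) :
    HasMellin (fun x : ℝ => ((Real.exp (-x) : ℝ) : ℂ)) s (Complex.Gamma s) := by
  constructor
  · refine IntegrableOn.congr_fun (Complex.GammaIntegral_convergent hs) (fun x _ => ?_)
      measurableSet_Ioi
    simp [mul_comm]
  · rw [Complex.Gamma_eq_integral hs, Complex.GammaIntegral_eq_mellin]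

/-- As 1/(1+x) = ∫ e^(-y) e^(-xy) dy, superposition gives Γ(s)Γ(1-s), and the reflection formula
applies. -/
theorem hasMellin_one_add_inv {s : ℂ} (h0 : 0 < s.re) (h1 : s.re < 1) :
    HasMellin (fun x : ℝ => (((1 + x)⁻¹ : ℝ) : ℂ)) s (Real.pi / Complex.sin (Real.pi * s)) := by
  rw [← Complex.Gamma_mul_Gamma_one_sub]
  refine ((hasMellin_exp_neg h0).superposition (by fun_prop) (by fun_prop)
    (hasMellin_exp_neg (s := 1 - s) (by simpa using h1))).congr_Ioi fun x hx => ?_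
  have : ∀ y : ℝ, ((Real.exp (-y) : ℝ) : ℂ) * ((Real.exp (-(x * y)) : ℝ) : ℂ)
      = ((Real.exp (-(1 + x) * y) : ℝ) : ℂ) := by
    intro y
    rw [← Complex.ofReal_mul, ← Real.exp_add]
    ring_nf
  simp only [this]
  rw [integral_complex_ofReal, integral_exp_mul_Ioi (by linarith) 0]
  simp only [mul_zero, Real.exp_zero, neg_div_neg_eq, one_div]

theorem hasMellin_one_add_sq_inv {s : ℂ} (h0 : 0 < s.re) (h1 : s.re < 2) :
    HasMellin (fun x : ℝ => (((1 + x ^ 2)⁻¹ : ℝ) : ℂ)) s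
      (Real.pi / (2 * Complex.sin (Real.pi * s / 2))) := by
  have e : (s / (2 : ℝ)).re = s.re / 2 := by simp
  have h := HasMellin.comp_rpow (s := s) (a := 2) two_ne_zero
    (hasMellin_one_add_inv (s := s / (2 : ℝ)) (by rw [e]; linarith) (by rw [e]; linarith))
  convert h using 1
  · simp
  · push_cast
    rw [mul_div_assoc, div_mul_eq_div_div, abs_two]
    push_cast
    ring

theorem integral_one_sub_cos_mul_exp {x : ℝ} (hx : 0 < x) :
    ∫ y in Ioi (0 : ℝ), (((1 - Real.cos y : ℝ)) : ℂ) * ((Real.exp (-(x * y)) : ℝ) : ℂ)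
      = ((x⁻¹ * (1 + x ^ 2)⁻¹ : ℝ) : ℂ) := by
  have hr (c : ℂ) (hc : c.re = 0) : ((-x : ℂ) + c).re < 0 := by simp [hc, hx]
  have e : ∀ y : ℝ, (((1 - Real.cos y : ℝ)) : ℂ) * ((Real.exp (-(x * y)) : ℝ) : ℂ)
      = Complex.exp ((-x + 0 : ℂ) * y) - (1 / 2 * Complex.exp ((-x + Complex.I) * y)
        + 1 / 2 * Complex.exp ((-x + -Complex.I) * y)) := by
    intro y
    push_cast
    rw [Complex.cos]
    simp only [add_mul, Complex.exp_add]
    ring_nf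
    simp
  simp only [e]
  have i0 := integrableOn_exp_mul_complex_Ioi (hr 0 rfl) 0
  have i1 := integrableOn_exp_mul_complex_Ioi (hr Complex.I Complex.I_re) 0
  have i2 := integrableOn_exp_mul_complex_Ioi (hr (-Complex.I) (by simp)) 0
  have hb : ∀ c : ℂ, c.re = 0 → (-x + c : ℂ) ≠ 0 := by
    intro c hc h0
    have := hr c hc
    rw [h0] at this
    simp at this
  rw [integral_sub i0 (by exact Integrable.add (i1.const_mul _) (i2.const_mul _)),
    integral_add (i1.const_mul _) (i2.const_mul _), integral_const_mul, integral_const_mul,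
    integral_exp_mul_complex_Ioi (hr 0 rfl), integral_exp_mul_complex_Ioi (hr _ Complex.I_re),
    integral_exp_mul_complex_Ioi (hr (-Complex.I) (by simp))]
  have h1 := hb 0 rfl
  have h2 := hb _ Complex.I_re
  have h3 := hb (-Complex.I) (by simp)
  have h4 : (x : ℂ) ≠ 0 := by exact_mod_cast hx.ne'
  have h5 : (1 + x ^ 2 : ℂ) ≠ 0 := by
    have : (1 + x ^ 2 : ℝ) ≠ 0 := by positivity
    exact_mod_cast this
  have hm : (-x + Complex.I : ℂ) * (-x + -Complex.I) = 1 + x ^ 2 := by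
    ring_nf
    simp
    ring
  have h6 : (1 : ℂ) / (-x + Complex.I) + 1 / (-x + -Complex.I) = -2 * x / (1 + x ^ 2) := by
    rw [div_add_div _ _ h2 h3, hm]
    ring
  have : (-(1 : ℂ) / (-x + 0) - (1 / 2 * (-1 / (-x + Complex.I))
      + 1 / 2 * (-1 / (-x + -Complex.I)))) = (x : ℂ)⁻¹ * (1 + (x : ℂ) ^ 2)⁻¹ := by
    have h7 : (-(1 : ℂ) / (-x + 0) - (1 / 2 * (-1 / (-x + Complex.I))
      + 1 / 2 * (-1 / (-x + -Complex.I)))) = 1 / x + 1 / 2 * ((1 : ℂ) / (-x + Complex.I)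
        + 1 / (-x + -Complex.I)) := by
      rw [add_zero, neg_div_neg_eq]; ring
    rw [h7, h6]
    field_simp
    ring
  simpa using this

/-- The function is bounded at infinity and O(x²) at the origin. -/
theorem mellinConvergent_one_sub_cos {τ : ℂ} (h0 : -2 < τ.re) (h1 : τ.re < 0) :
    MellinConvergent (fun y : ℝ => (((1 - Real.cos y : ℝ)) : ℂ)) τ := by
  refine mellinConvergent_of_isBigO_rpow (a := 0) (b := -2) ?_ ?_ h1 ?_ h0
  · exact (Continuous.locallyIntegrable (by fun_prop)).locallyIntegrableOn _
  · refine Asymptotics.IsBigO.of_bound 2 (Filter.Eventually.of_forall fun x => ?_)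
    have := Real.cos_le_one x
    have := Real.neg_one_le_cos x
    simp only [neg_zero, Real.rpow_zero, norm_one, Complex.norm_real, Real.norm_eq_abs]
    rw [abs_of_nonneg (by linarith)]
    linarith
  · refine Asymptotics.IsBigO.of_bound 1 (Filter.Eventually.of_forall fun x => ?_)
    have := Real.cos_le_one x
    have := Real.one_sub_sq_div_two_le_cos (x := x)
    simp only [neg_neg, Real.rpow_two, Complex.norm_real, Real.norm_eq_abs]
    rw [abs_of_nonneg (by linarith), abs_of_nonneg (sq_nonneg x)]
    nlinarith [sq_nonneg x]

/-- The Laplace transform x⁻¹(1+x²)⁻¹ has a known Mellin transform at 1-τ. By superposition with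
e^(-x) it also equals Γ(1-τ) times the unknown one, and Γ(1-τ) ≠ 0 can be divided out. -/
theorem hasMellin_one_sub_cos {τ : ℂ} (h0 : -2 < τ.re) (h1 : τ.re < 0) :
    HasMellin (fun y : ℝ => (((1 - Real.cos y : ℝ)) : ℂ)) τ
      (Real.pi / (2 * Complex.sin (Real.pi * (-τ) / 2)) / Complex.Gamma (1 - τ)) := by
  have hc := mellinConvergent_one_sub_cos h0 h1
  refine ⟨hc, ?_⟩
  have hre : 0 < (1 - τ).re := by simp; linarith
  have hA := (hasMellin_exp_neg hre).superposition (W := fun y : ℝ => (((1 - Real.cos y : ℝ)) : ℂ))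
    (by fun_prop) (by fun_prop) (G := mellin (fun y : ℝ => (((1 - Real.cos y : ℝ)) : ℂ)) τ)
    ⟨by simpa using hc, by simp⟩
  have hB : HasMellin (fun x : ℝ => (x : ℂ) ^ (-1 : ℂ) * (((1 + x ^ 2)⁻¹ : ℝ) : ℂ)) (1 - τ)
      (Real.pi / (2 * Complex.sin (Real.pi * (-τ) / 2))) := by
    refine HasMellin.cpow_mul ?_
    rw [show (1 - τ + -1 : ℂ) = -τ by ring]
    exact hasMellin_one_add_sq_inv (by simpa using h1) (by simp; linarith)
  have hB' := hB.congr_Ioi (g := fun x => ∫ y in Ioi (0 : ℝ),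
      (((1 - Real.cos y : ℝ)) : ℂ) * ((Real.exp (-(x * y)) : ℝ) : ℂ)) fun x hx => by
    rw [integral_one_sub_cos_mul_exp hx, Complex.cpow_neg_one]
    push_cast
    rfl
  have h := hA.2.symm.trans hB'.2
  rw [← h, mul_div_cancel_left₀ _ (Complex.Gamma_ne_zero_of_re_pos hre)]

/-! ### Euler averages: Mellin transform, power series, positivity -/

/-- The weight of Euler's beta integral, extended by zero outside `(0, 1)`. -/
noncomputable def eulerWeight (p q : ℝ) : ℝ → ℝ :=
  (Ioo (0 : ℝ) 1).indicator fun y => y ^ (p - 1) * (1 - y) ^ (q - 1)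

/-- The Erdélyi–Kober average `∫₀¹ y^(p-1) (1-y)^(q-1) f(xy) dy`. -/
noncomputable def eulerTransform (p q : ℝ) (f : ℝ → ℝ) (x : ℝ) : ℝ :=
  ∫ y in Ioi (0 : ℝ), eulerWeight p q y * f (x * y)

theorem measurable_eulerWeight (p q : ℝ) : Measurable (eulerWeight p q) :=
  Measurable.indicator (by fun_prop) measurableSet_Ioo

theorem measurable_eulerTransform (p q : ℝ) {f : ℝ → ℝ} (hf : Measurable f) :
    Measurable (eulerTransform p q f) := by
  have h : Measurable (Function.uncurry fun x y : ℝ => eulerWeight p q y * f (x * y)) := by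
    have := measurable_eulerWeight p q
    simp only [Function.uncurry_def]
    fun_prop
  exact (h.stronglyMeasurable.integral_prod_right (ν := volume.restrict (Ioi (0 : ℝ)))).measurable

theorem eulerWeight_nonneg (p q y : ℝ) : 0 ≤ eulerWeight p q y := by
  refine indicator_nonneg (fun y hy => ?_) y
  have := hy.1
  have := sub_pos.2 hy.2
  positivity

theorem eulerWeight_pos (p q : ℝ) {y : ℝ} (hy : y ∈ Ioo (0 : ℝ) 1) : 0 < eulerWeight p q y := by
  rw [eulerWeight, indicator_of_mem hy]
  have := hy.1
  have := sub_pos.2 hy.2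
  positivity

theorem hasMellin_eulerWeight {p q : ℝ} {z : ℂ} (hz : 0 < p - 1 + z.re) (hq : 0 < q) :
    HasMellin (fun y => (eulerWeight p q y : ℂ)) z (Complex.betaIntegral (p - 1 + z) q) := by
  set B : ℝ → ℂ := fun y => (y : ℂ) ^ ((p : ℂ) - 1 + z - 1) * (1 - (y : ℂ)) ^ ((q : ℂ) - 1) with hB
  have e : (fun y : ℝ => (y : ℂ) ^ (z - 1) • (eulerWeight p q y : ℂ)) =
      (Ioo (0 : ℝ) 1).indicator B := by
    funext y
    by_cases hy : y ∈ Ioo (0 : ℝ) 1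
    · have hy0 : (y : ℂ) ≠ 0 := Complex.ofReal_ne_zero.2 hy.1.ne'
      rw [eulerWeight, indicator_of_mem hy, indicator_of_mem hy, hB]
      push_cast
      rw [Complex.ofReal_cpow hy.1.le, Complex.ofReal_cpow (sub_pos.2 hy.2).le, smul_eq_mul,
        ← mul_assoc, ← Complex.cpow_add _ _ hy0]
      push_cast
      ring_nf
    · rw [eulerWeight, indicator_of_notMem hy, indicator_of_notMem hy]
      simp
  have hc := Complex.betaIntegral_convergent (u := p - 1 + z) (v := q) (by simpa using hz)
    (by simpa using hq)
  rw [intervalIntegrable_iff_integrableOn_Ioo_of_le zero_le_one] at hc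
  have hsub : Ioi (0 : ℝ) ∩ Ioo 0 1 = Ioo 0 1 := inter_eq_right.2 Ioo_subset_Ioi_self
  constructor
  · rw [MellinConvergent, e]
    exact ((integrable_indicator_iff measurableSet_Ioo).2 hc).integrableOn
  · rw [mellin, e, setIntegral_indicator measurableSet_Ioo, hsub, Complex.betaIntegral,
      intervalIntegral.integral_of_le zero_le_one, integral_Ioc_eq_integral_Ioo]

theorem HasMellin.eulerTransform {p q : ℝ} {f : ℝ → ℝ} {s F : ℂ} (hfm : Measurable f)
    (hf : HasMellin (fun x => (f x : ℂ)) s F) (hs : s.re < p) (hq : 0 < q) :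
    HasMellin (fun x => (eulerTransform p q f x : ℂ)) s (F * Complex.betaIntegral (p - s) q) := by
  have hw := hasMellin_eulerWeight (p := p) (q := q) (z := 1 - s) (by simpa using hs) hq
  rw [show (p : ℂ) - 1 + (1 - s) = p - s by ring] at hw
  have hm := measurable_eulerWeight p q
  refine (hf.superposition (by fun_prop) (by fun_prop) hw).congr_Ioi fun x _ => ?_
  rw [_root_.eulerTransform, ← integral_complex_ofReal]
  simp

theorem integrableOn_eulerWeight_mul_pow {p q : ℝ} {n : ℕ} (hn : 0 < p + n) (hq : 0 < q) :
    IntegrableOn (fun y => eulerWeight p q y * y ^ n) (Ioi 0) ∧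
    ∫ y in Ioi (0 : ℝ), eulerWeight p q y * y ^ n
      = Real.Gamma (p + n) * Real.Gamma q / Real.Gamma (p + n + q) := by
  have h := hasMellin_eulerWeight (p := p) (q := q) (z := (n : ℂ) + 1)
    (by simp; linarith) hq
  have e : ∀ y : ℝ, (y : ℂ) ^ ((n : ℂ) + 1 - 1) • (eulerWeight p q y : ℂ)
      = ((eulerWeight p q y * y ^ n : ℝ) : ℂ) := by
    intro y
    rw [add_sub_cancel_right, Complex.cpow_natCast]
    push_cast
    rw [smul_eq_mul, mul_comm]
  constructor
  · have h1 := h.1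
    simp only [MellinConvergent, e] at h1
    exact h1.re
  · have h2 := h.2
    simp only [mellin, e] at h2
    rw [integral_complex_ofReal, show (p : ℂ) - 1 + (n + 1) = ((p + n : ℝ) : ℂ) by push_cast; ring,
      Complex.betaIntegral_eq_Gamma_mul_div _ _ (by simpa using hn) (by simpa using hq),
      ← Complex.ofReal_add, Complex.Gamma_ofReal, Complex.Gamma_ofReal, Complex.Gamma_ofReal] at h2
    exact_mod_cast h2

/-- Termwise integration is legitimate because the weight lives on (0,1), where y^(m j) ≤ y^M: one
integrable majorant serves all terms. Only p + M > 0 is required, so p itself may be negative. -/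
theorem hasSum_eulerTransform {p q : ℝ} {f : ℝ → ℝ} {c : ℕ → ℝ} {m : ℕ → ℕ} {M : ℕ}
    (hfm : Measurable f) (hM : ∀ j, M ≤ m j) (hp : 0 < p + M) (hq : 0 < q)
    (hf : ∀ x, 0 < x → HasSum (fun j => c j * x ^ m j) (f x)) {x : ℝ} (hx : 0 < x) :
    IntegrableOn (fun y => eulerWeight p q y * f (x * y)) (Ioi 0) ∧
    HasSum (fun j => c j * x ^ m j *
      (Real.Gamma (p + m j) * Real.Gamma q / Real.Gamma (p + m j + q)))
      (eulerTransform p q f x) := by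
  have hpj : ∀ j, 0 < p + m j := fun j => by
    have : (M : ℝ) ≤ m j := by exact_mod_cast hM j
    linarith
  have hsum : Summable fun j => |c j| * x ^ m j := by
    refine (hf x hx).summable.abs.congr fun j => ?_
    rw [abs_mul, abs_of_nonneg (pow_nonneg hx.le _)]
  have hbase := integrableOn_eulerWeight_mul_pow hp hq
  have hpow : ∀ j, ∀ y ∈ Ioi (0 : ℝ),
      eulerWeight p q y * y ^ m j ≤ eulerWeight p q y * y ^ M := by
    intro j y hy
    by_cases hy1 : y < 1
    · exact mul_le_mul_of_nonneg_left (pow_le_pow_of_le_one (le_of_lt hy) hy1.le (hM j))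
        (eulerWeight_nonneg p q y)
    · rw [eulerWeight, indicator_of_notMem fun h => hy1 h.2]
      simp
  have hwm := measurable_eulerWeight p q
  have hterm : ∀ y ∈ Ioi (0 : ℝ),
      HasSum (fun j => eulerWeight p q y * (c j * (x * y) ^ m j)) (eulerWeight p q y * f (x * y)) :=
    fun y hy => (hf (x * y) (mul_pos hx hy)).mul_left _
  have hnorm : ∀ j, ∀ y ∈ Ioi (0 : ℝ), ‖eulerWeight p q y * (c j * (x * y) ^ m j)‖
      = |c j| * x ^ m j * (eulerWeight p q y * y ^ m j) := by
    intro j y hy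
    have hy' : (0 : ℝ) < y := hy
    rw [Real.norm_eq_abs, abs_mul, abs_mul, abs_of_nonneg (eulerWeight_nonneg p q y),
      abs_of_pos (pow_pos (mul_pos hx hy') _), mul_pow]
    ring
  have hint : ∀ j, IntegrableOn (fun y => eulerWeight p q y * (c j * (x * y) ^ m j)) (Ioi 0) := by
    intro j
    refine ((integrableOn_eulerWeight_mul_pow (hpj j) hq).1.const_mul (c j * x ^ m j)).congr
      (ae_of_all _ fun y => ?_)
    simp only [mul_pow]
    ring
  constructor
  · refine Integrable.mono' (hbase.1.const_mul (∑' j, |c j| * x ^ m j))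
      (by fun_prop) ((ae_restrict_iff' measurableSet_Ioi).2 (ae_of_all _ fun y hy => ?_))
    rw [← (hterm y hy).tsum_eq]
    have hle : ∀ j, ‖eulerWeight p q y * (c j * (x * y) ^ m j)‖
        ≤ |c j| * x ^ m j * (eulerWeight p q y * y ^ M) := fun j => by
      rw [hnorm j y hy]
      exact mul_le_mul_of_nonneg_left (hpow j y hy) (by positivity)
    exact tsum_of_norm_bounded (hsum.hasSum.mul_right _) hle
  · have h := hasSum_integral_of_summable_integral_norm hint (by
      refine Summable.of_nonneg_of_le (fun j => integral_nonneg fun y => norm_nonneg _)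
        (fun j => ?_) (hsum.mul_right (∫ y in Ioi (0 : ℝ), eulerWeight p q y * y ^ M))
      rw [setIntegral_congr_fun measurableSet_Ioi (hnorm j), integral_const_mul]
      exact mul_le_mul_of_nonneg_left (setIntegral_mono_on
        (integrableOn_eulerWeight_mul_pow (hpj j) hq).1 hbase.1 measurableSet_Ioi (hpow j))
        (by positivity))
    rw [setIntegral_congr_fun measurableSet_Ioi fun y hy => (hterm y hy).tsum_eq] at h
    refine h.congr_fun fun j => ?_
    rw [← (integrableOn_eulerWeight_mul_pow (hpj j) hq).2, ← integral_const_mul]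
    congr 1
    funext y
    rw [mul_pow]
    ring

theorem eulerTransform_pos {p q : ℝ} {f : ℝ → ℝ} {x : ℝ} (hx : 0 < x)
    (h0 : ∀ y, 0 < y → 0 ≤ f y) (h1 : ∀ y ∈ Ioo (0 : ℝ) 1, 0 < f y)
    (hi : IntegrableOn (fun y => eulerWeight p q y * f (x * y)) (Ioi 0)) :
    0 < eulerTransform p q f x := by
  rw [eulerTransform, setIntegral_pos_iff_support_of_nonneg_ae _ hi]
  -- On (0, min(1, 1/x)) both the weight and f(xy) are strictly positive.
  · refine lt_of_lt_of_le (b := volume (Ioo 0 (min 1 x⁻¹))) (by simp [hx]) (measure_mono ?_)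
    intro y hy
    have hy1 : y < 1 := hy.2.trans_le (min_le_left _ _)
    have hy2 : x * y < 1 := by
      have := hy.2.trans_le (min_le_right _ _)
      rwa [lt_inv_comm₀ hy.1 hx, inv_eq_one_div, lt_div_iff₀ hy.1] at this
    exact ⟨(mul_pos (eulerWeight_pos p q ⟨hy.1, hy1⟩) (h1 _ ⟨mul_pos hx hy.1, hy2⟩)).ne', hy.1⟩
  · exact (ae_restrict_iff' measurableSet_Ioi).2 (ae_of_all _ fun y hy =>
      mul_nonneg (eulerWeight_nonneg p q y) (h0 _ (mul_pos hx hy)))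

/-! ### Averages of 1 - cos -/

theorem hasSum_one_sub_cos (x : ℝ) :
    HasSum (fun j : ℕ => (-1) ^ j / ((2 * j + 2).factorial : ℝ) * x ^ (2 * j + 2))
      (1 - Real.cos x) := by
  have h := (hasSum_nat_add_iff' 1).2 (Real.hasSum_cos x)
  have h' := h.neg
  simp only [Finset.range_one, Finset.sum_singleton, mul_zero, pow_zero, Nat.factorial_zero,
    Nat.cast_one, div_one, mul_one, neg_sub] at h'
  refine h'.congr_fun fun j => ?_
  rw [mul_add, mul_one, pow_succ]
  ring

/-- The function `∑ (-1)^j x^(2(j+w+1)) / Γ(β + 2(j+w+1) + 1)`: sign and Mellin transform. -/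
theorem exists_lommel {β : ℝ} (hβ : 0 ≤ β) (w : ℕ) :
    ∃ H : ℝ → ℝ, Measurable H ∧ (∀ x, 0 < x → 0 ≤ H x) ∧ (∀ x ∈ Ioo (0 : ℝ) 1, 0 < H x) ∧
      (∀ x, 0 < x → HasSum (fun j : ℕ => (-1) ^ j /
        Real.Gamma (β + (2 * (j + (w + 1)) : ℕ) + 1) * x ^ (2 * (j + (w + 1)))) (H x)) ∧
      ∀ σ : ℂ, -2 < σ.re + 2 * w → σ.re + 2 * w < 0 →
        HasMellin (fun x => (H x : ℂ)) σ (Real.pi /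
          (2 * Complex.sin (Real.pi * (-(σ + 2 * w)) / 2)) / Complex.Gamma (1 - σ + β)) := by
  have hcos0 : ∀ x : ℝ, 0 < x → 0 ≤ 1 - Real.cos x := fun x _ => sub_nonneg.2 (Real.cos_le_one x)
  have hcos1 : ∀ x ∈ Ioo (0 : ℝ) 1, 0 < 1 - Real.cos x := fun x hx => by
    have h := Real.cos_lt_cos_of_nonneg_of_le_pi le_rfl
      (hx.2.le.trans (by linarith [Real.pi_gt_three])) hx.1
    rw [Real.cos_zero] at h
    linarith
  -- The weight exponent q = 2w+β must be positive. It vanishes only for w = β = 0, where 1 - cos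
  -- needs no averaging.
  rcases eq_or_lt_of_le (show 0 ≤ 2 * (w : ℝ) + β by positivity) with ha | ha
  · have hw0 : (w : ℝ) = 0 := by
      have : (0 : ℝ) ≤ w := Nat.cast_nonneg w
      linarith
    have hβ0 : β = 0 := by linarith
    have hw : w = 0 := by exact_mod_cast hw0
    subst hw hβ0
    refine ⟨fun x => 1 - Real.cos x, by fun_prop, hcos0, hcos1, fun x _ => ?_, fun σ h0 h1 => ?_⟩
    · refine (hasSum_one_sub_cos x).congr_fun fun j => ?_
      rw [zero_add, Real.Gamma_nat_eq_factorial]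
      ring_nf
    · convert hasMellin_one_sub_cos (τ := σ) (by simpa using h0) (by simpa using h1) using 2
      · simp
      · simp
  · set a : ℝ := 2 * w + β with ha'
    have hG := (Real.Gamma_pos_of_pos ha)
    have hser := fun {x : ℝ} (hx : 0 < x) =>
      hasSum_eulerTransform (p := 1) (q := a) (f := fun x => 1 - Real.cos x)
        (c := fun j : ℕ => (-1) ^ j / ((2 * j + 2).factorial : ℝ)) (m := fun j => 2 * j + 2)
        (M := 2) (by fun_prop) (fun j => by lia) (by norm_num) ha
        (fun x _ => hasSum_one_sub_cos x) hx
    have hpos : ∀ x : ℝ, 0 < x →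
        0 < x ^ (2 * w) * ((Real.Gamma a)⁻¹ * eulerTransform 1 a (fun x => 1 - Real.cos x) x) :=
      fun x hx => by
        have := eulerTransform_pos hx hcos0 hcos1 (hser hx).1
        positivity
    refine ⟨fun x => x ^ (2 * w) *
      ((Real.Gamma a)⁻¹ * eulerTransform 1 a (fun x => 1 - Real.cos x) x), ?_,
      fun x hx => (hpos x hx).le, fun x hx => hpos x hx.1, fun x hx => ?_, fun σ h0 h1 => ?_⟩
    · have := measurable_eulerTransform 1 a (f := fun x => 1 - Real.cos x) (by fun_prop)
      fun_prop
    · refine (((hser hx).2.mul_left (Real.Gamma a)⁻¹).mul_left (x ^ (2 * w))).congr_fun fun j => ?_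
      have e1 : (1 : ℝ) + ((2 * j + 2 : ℕ) : ℝ) + a = β + ((2 * (j + (w + 1)) : ℕ) : ℝ) + 1 := by
        rw [ha']
        push_cast
        ring
      have e2 : Real.Gamma (1 + ((2 * j + 2 : ℕ) : ℝ)) = (2 * j + 2).factorial := by
        rw [add_comm, Real.Gamma_nat_eq_factorial]
      have hf : ((2 * j + 2).factorial : ℝ) ≠ 0 := by positivity
      have hg : Real.Gamma (β + ((2 * (j + (w + 1)) : ℕ) : ℝ) + 1) ≠ 0 :=
        (Real.Gamma_pos_of_pos (by positivity)).ne'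
      rw [e1, e2]
      field_simp
      ring
    · have hre : (σ + 2 * w).re = σ.re + 2 * w := by simp
      have hM := (hasMellin_one_sub_cos (τ := σ + 2 * w) (by rwa [hre]) (by rwa [hre])).eulerTransform
        (p := 1) (q := a) (by fun_prop) (by rw [hre]; linarith) ha
      have hre2 : 0 < (1 - (σ + 2 * w)).re := by
        rw [Complex.sub_re, hre, Complex.one_re]
        linarith
      have hM2 := (hM.const_mul (Real.Gamma a : ℂ)⁻¹).cpow_mul (s := σ) (a := 2 * w)
      have hGa : (Real.Gamma a : ℂ) ≠ 0 := by exact_mod_cast hG.ne'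
      have hGs := Complex.Gamma_ne_zero_of_re_pos hre2
      convert hM2 using 1
      · funext x
        push_cast
        rw [show (2 * (w : ℂ)) = ((2 * w : ℕ) : ℂ) by push_cast; ring, Complex.cpow_natCast]
      -- With τ = σ+2w, the Beta factor Γ(1-τ)Γ(a)/Γ(1-τ+a) replaces Γ(1-τ) in the denominator by
      -- Γ(1-σ+β).
      · rw [Complex.ofReal_one, Complex.betaIntegral_eq_Gamma_mul_div _ _ hre2 (by simpa using ha),
          Complex.Gamma_ofReal a, show (1 - (σ + 2 * w) + a : ℂ) = 1 - σ + β by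
            rw [ha']; push_cast; ring]
        field_simp

/-- The function `∑ (-1)^j x^(2k) / (Γ(β + 2k + 1) (2k + β - 1/2))` with `k = j + w + 1`. -/
theorem exists_lommel_average {β : ℝ} (hβ : 0 ≤ β) (w : ℕ) :
    ∃ F : ℝ → ℝ, (∀ x, 0 < x → 0 < F x) ∧
      (∀ x, 0 < x → HasSum (fun j : ℕ => (-1) ^ j /
        Real.Gamma (β + (2 * (j + (w + 1)) : ℕ) + 1) * x ^ (2 * (j + (w + 1))) /
          ((2 * (j + (w + 1)) : ℕ) + β - 1 / 2)) (F x)) ∧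
      ∀ σ : ℂ, -2 < σ.re + 2 * w → σ.re + 2 * w < 0 → σ.re < β - 1 / 2 →
        HasMellin (fun x => (F x : ℂ)) σ (Real.pi /
          (2 * Complex.sin (Real.pi * (-(σ + 2 * w)) / 2)) / Complex.Gamma (1 - σ + β) /
          (β - 1 / 2 - σ)) := by
  obtain ⟨H, hm, h0, h1, hs, hM⟩ := exists_lommel hβ w
  -- The weight y^(β-3/2) may fail to be integrable at 0; as every exponent is at least M = 2, p + M
  -- ≥ 3/2 suffices.
  have hser := fun {x : ℝ} (hx : 0 < x) =>
    hasSum_eulerTransform (p := β - 1 / 2) (q := 1) (f := H)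
      (c := fun j : ℕ => (-1) ^ j / Real.Gamma (β + (2 * (j + (w + 1)) : ℕ) + 1))
      (m := fun j => 2 * (j + (w + 1))) (M := 2) hm (fun j => by lia)
      (by push_cast; linarith) one_pos hs hx
  refine ⟨eulerTransform (β - 1 / 2) 1 H, fun x hx => eulerTransform_pos hx h0 h1 (hser hx).1,
    fun x hx => (hser hx).2.congr_fun fun j => ?_, fun σ hl hr hσ => ?_⟩
  · have hp : 0 < β - 1 / 2 + ((2 * (j + (w + 1)) : ℕ) : ℝ) := by
      push_cast
      have : (0 : ℝ) ≤ j := Nat.cast_nonneg j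
      have : (0 : ℝ) ≤ w := Nat.cast_nonneg w
      linarith
    have := (Real.Gamma_pos_of_pos hp).ne'
    rw [Real.Gamma_add_one hp.ne', Real.Gamma_one, mul_one, div_mul_cancel_right₀ this,
      div_eq_mul_inv _ (_ - _)]
    ring_nf
  · have h := (hM σ hl hr).eulerTransform (p := β - 1 / 2) (q := 1) hm hσ one_pos
    have hre : 0 < (((β - 1 / 2 : ℝ) : ℂ) - σ).re := by
      rw [Complex.sub_re, Complex.ofReal_re]
      linarith
    rw [Complex.ofReal_one, Complex.betaIntegral_eval_one_right hre, mul_one_div] at h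
    push_cast at h
    exact h

/-! ### Absolute convergence of the two series -/

namespace ZetaMellin

theorem gamma_mul_poch {β : ℝ} (hβ : 0 ≤ β) (n : ℕ) :
    Complex.Gamma (1 + β) * poch (1 + β) n = (Real.Gamma (β + n + 1) : ℂ) := by
  induction n with
  | zero =>
    simp [poch, ← Complex.Gamma_ofReal, add_comm]
  | succ n ih =>
    have h : poch (1 + β) (n + 1) = poch (1 + β) n * (1 + β + n) := Finset.prod_range_succ _ _
    have hn : β + n + 1 ≠ 0 := by positivity
    rw [h, ← mul_assoc, ih, show β + ((n + 1 : ℕ) : ℝ) + 1 = (β + n + 1) + 1 by push_cast; ring,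
      Real.Gamma_add_one hn]
    push_cast
    ring

theorem gamma_one_add_ne_zero {β : ℝ} (hβ : 0 ≤ β) : Complex.Gamma (1 + β) ≠ 0 :=
  Complex.Gamma_ne_zero_of_re_pos (by simp; linarith)

theorem poch_ne_zero {β : ℝ} (hβ : 0 ≤ β) (n : ℕ) : poch (1 + β) n ≠ 0 := by
  intro h
  have := gamma_mul_poch hβ n
  rw [h, mul_zero] at this
  have hp : (0 : ℝ) < Real.Gamma (β + n + 1) := Real.Gamma_pos_of_pos (by positivity)
  exact hp.ne (by exact_mod_cast this)

theorem factorial_le_norm_poch {β : ℝ} (hβ : 0 ≤ β) (n : ℕ) :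
    (n.factorial : ℝ) ≤ ‖poch (1 + β) n‖ := by
  induction n with
  | zero => simp [poch]
  | succ n ih =>
    have h : poch (1 + β) (n + 1) = poch (1 + β) n * (1 + β + n) := Finset.prod_range_succ _ _
    have h1 : ‖(1 + β + n : ℂ)‖ = 1 + β + n := by
      rw [show (1 + β + n : ℂ) = ((1 + β + n : ℝ) : ℂ) by push_cast; ring, Complex.norm_real,
        Real.norm_of_nonneg (by positivity)]
    rw [h, norm_mul, h1, Nat.factorial_succ, mul_comm (n + 1)]
    push_cast
    exact mul_le_mul ih (by linarith) (by positivity) (norm_nonneg _)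

theorem one_le_norm_linear {β : ℝ} (hβ : 0 ≤ β) {k : ℕ} (hk : 1 ≤ k) :
    1 ≤ ‖(2 * k + β - 1 / 2 : ℂ)‖ := by
  have : (1 : ℝ) ≤ k := by exact_mod_cast hk
  rw [show (2 * k + β - 1 / 2 : ℂ) = ((2 * k + β - 1 / 2 : ℝ) : ℂ) by push_cast; ring,
    Complex.norm_real, Real.norm_of_nonneg (by linarith)]
  linarith

theorem hasSum_pnat_cpow_neg {s : ℂ} (hs : 1 < s.re) :
    HasSum (fun n : ℕ+ => ((n : ℕ) : ℂ) ^ (-s)) (riemannZeta s) := by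
  have h : Summable fun n : ℕ => 1 / (n : ℂ) ^ s := Complex.summable_one_div_nat_cpow.2 hs
  have h1 := ((summable_nat_add_iff 1).2 h).hasSum
  have h2 : ∑' n : ℕ, 1 / ((n + 1 : ℕ) : ℂ) ^ s = riemannZeta s := by
    rw [zeta_eq_tsum_one_div_nat_add_one_cpow hs]
    push_cast
    rfl
  rw [h2] at h1
  refine (Equiv.pnatEquivNat.symm.hasSum_iff).1 (h1.congr_fun fun n => ?_)
  simp [Complex.cpow_neg]

/-- The Dirichlet series has nonnegative terms and first term 1. Dividing by such zeta values thus
never enlarges a term. -/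
theorem one_le_norm_riemannZeta {x : ℝ} (hx : 1 < x) : 1 ≤ ‖riemannZeta x‖ := by
  have h := Complex.hasSum_re (hasSum_pnat_cpow_neg (s := x) (by simpa using hx))
  have h1 := le_hasSum h 1 fun n _ => by
    rw [← Complex.ofReal_neg, ← Complex.ofReal_natCast, ← Complex.ofReal_cpow (Nat.cast_nonneg _),
      Complex.ofReal_re]
    positivity
  simp only [PNat.one_coe, Nat.cast_one, Complex.one_cpow, Complex.one_re] at h1
  exact h1.trans (Complex.re_le_norm _)

theorem one_le_norm_zeta {β : ℝ} (hβ : 0 ≤ β) {k : ℕ} (hk : 1 ≤ k) :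
    1 ≤ ‖riemannZeta (2 * β + 4 * k)‖ := by
  have : (1 : ℝ) ≤ k := by exact_mod_cast hk
  have h := one_le_norm_riemannZeta (x := 2 * β + 4 * k) (by linarith)
  push_cast at h
  exact h

theorem norm_T0Term_le {β : ℝ} (hβ : 0 ≤ β) (z : ℂ) {k : ℕ} (hk : 1 ≤ k) :
    ‖T0Term z β k‖ ≤ ‖Real.pi * z‖ ^ (2 * k) / ((2 * k).factorial : ℝ) := by
  rw [T0Term, norm_div, norm_pow, norm_mul]
  refine div_le_div_of_nonneg_left (by positivity) (by positivity) ?_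
  have h1 := factorial_le_norm_poch hβ (2 * k)
  have h2 := one_le_norm_linear hβ hk
  rw [norm_mul]
  calc ((2 * k).factorial : ℝ) = (2 * k).factorial * 1 := by ring
    _ ≤ _ := by gcongr

theorem norm_PTerm_le {β : ℝ} (hβ : 0 ≤ β) (z : ℂ) {k : ℕ} (hk : 1 ≤ k) :
    ‖PTerm z β k‖ ≤ ‖z‖ ^ (2 * k) / ((2 * k).factorial : ℝ) := by
  rw [PTerm, norm_div, norm_mul, norm_mul, norm_mul, norm_pow, norm_pow, norm_neg, norm_one,
    one_pow, one_mul]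
  refine div_le_div_of_nonneg_left (by positivity) (by positivity) ?_
  have h1 := factorial_le_norm_poch hβ (2 * k)
  have h2 := one_le_norm_linear hβ hk
  have h3 := one_le_norm_zeta hβ hk
  calc ((2 * k).factorial : ℝ) = (2 * k).factorial * 1 * 1 := by ring
    _ ≤ _ := by gcongr

theorem summable_pow_div_factorial_even (x : ℝ) (w : ℕ) :
    Summable fun j : ℕ => x ^ (2 * (j + (w + 1))) / ((2 * (j + (w + 1))).factorial : ℝ) :=
  (Real.summable_pow_div_factorial x).comp_injective
    (i := fun j : ℕ => 2 * (j + (w + 1))) fun a b h => by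
      simp only at h
      lia

theorem summable_T0Term {β : ℝ} (hβ : 0 ≤ β) (w : ℕ) (z : ℂ) :
    Summable fun j : ℕ => T0Term z β (j + (w + 1)) :=
  Summable.of_norm_bounded (summable_pow_div_factorial_even _ w)
    fun _ => norm_T0Term_le hβ z (by lia)

theorem summable_PTerm {β : ℝ} (hβ : 0 ≤ β) (w : ℕ) (z : ℂ) :
    Summable fun j : ℕ => PTerm z β (j + (w + 1)) :=
  Summable.of_norm_bounded (summable_pow_div_factorial_even _ w)
    fun _ => norm_PTerm_le hβ z (by lia)

/-! ### T₀ on the imaginary axis -/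

/-- The even powers of `π i r`. -/
theorem pi_mul_I_mul_pow (r : ℝ) (k : ℕ) :
    ((Real.pi : ℂ) * (Complex.I * r)) ^ (2 * k) = (-1) ^ k * (Real.pi * r : ℂ) ^ (2 * k) := by
  rw [show (Real.pi : ℂ) * (Complex.I * r) = Complex.I * (Real.pi * r) by ring, mul_pow,
    pow_mul Complex.I, Complex.I_sq]

theorem T0Term_I_mul {β : ℝ} (hβ : 0 ≤ β) (r : ℝ) (w j : ℕ) :
    T0Term (Complex.I * r) β (j + (w + 1)) = (-1) ^ (w + 1) * Complex.Gamma (1 + β) *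
      (((-1) ^ j / Real.Gamma (β + (2 * (j + (w + 1)) : ℕ) + 1) *
        (Real.pi * r) ^ (2 * (j + (w + 1))) /
          ((2 * (j + (w + 1)) : ℕ) + β - 1 / 2) : ℝ) : ℂ) := by
  rw [T0Term, pi_mul_I_mul_pow]
  push_cast only [Complex.ofReal_mul, Complex.ofReal_div]
  rw [← gamma_mul_poch hβ]
  have h1 := gamma_one_add_ne_zero hβ
  have h2 := poch_ne_zero hβ (2 * (j + (w + 1)))
  push_cast
  rw [pow_add (-1 : ℂ) j]
  field_simp

theorem T0_I_mul_eq {β : ℝ} (hβ : 0 ≤ β) {w : ℕ} {r F : ℝ}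
    (hF : HasSum (fun j : ℕ => (-1) ^ j / Real.Gamma (β + (2 * (j + (w + 1)) : ℕ) + 1) *
      (Real.pi * r) ^ (2 * (j + (w + 1))) / ((2 * (j + (w + 1)) : ℕ) + β - 1 / 2)) F) :
    T0 (Complex.I * r) β w = ((Real.pi ^ (β - 1) * F : ℝ) : ℂ) := by
  have h := (Complex.hasSum_ofReal.2 hF).mul_left ((-1) ^ (w + 1) * Complex.Gamma (1 + β))
  rw [T0, (h.congr_fun fun j => T0Term_I_mul hβ r w j).tsum_eq]
  have h1 := gamma_one_add_ne_zero hβ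
  have h2 : (Real.pi : ℂ) ^ (1 - β : ℂ) ≠ 0 := by
    simp [Complex.cpow_eq_zero_iff, Real.pi_ne_zero]
  have h3 : (Real.pi : ℂ) ^ (1 - β : ℂ) * (Real.pi : ℂ) ^ (β - 1 : ℂ) = 1 := by
    rw [← Complex.cpow_add _ _ (by exact_mod_cast Real.pi_ne_zero)]
    simp
  have h4 : ((-1 : ℂ) ^ (w + 1)) * (-1) ^ (w + 1) = 1 := by
    rw [← mul_pow]; simp
  push_cast
  rw [Complex.ofReal_cpow Real.pi_pos.le]
  push_cast
  field_simp
  linear_combination (F : ℂ) * h4 - (F : ℂ) * h3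

/-! ### Expansion of T₀ in dilates of P -/

theorem PTerm_mul_cpow {β : ℝ} (r : ℝ) (k : ℕ) (n : ℕ+) :
    ((n : ℕ) : ℂ) ^ (-(2 * (β : ℂ))) *
        PTerm ((Real.pi * r / ((n : ℕ) : ℝ) ^ 2 : ℝ) : ℂ) β k
      = T0Term (Complex.I * r) β k *
        (((n : ℕ) : ℂ) ^ (-(2 * (β : ℂ) + 4 * k)) / riemannZeta (2 * β + 4 * k)) := by
  have hn : ((n : ℕ) : ℂ) ≠ 0 := by exact_mod_cast n.ne_zero
  rw [T0Term, PTerm, pi_mul_I_mul_pow, neg_add, Complex.cpow_add _ _ hn,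
    Complex.cpow_neg _ (4 * k), show (4 * k : ℂ) = ((4 * k : ℕ) : ℂ) by push_cast; ring,
    Complex.cpow_natCast, show 4 * k = 2 * (2 * k) by ring, pow_mul _ 2 (2 * k)]
  push_cast
  simp only [div_eq_mul_inv, mul_inv, mul_pow, inv_pow]
  ring

theorem hasSum_PTerm_mul_cpow {β : ℝ} (hβ : 0 ≤ β) (r : ℝ) {k : ℕ} (hk : 1 ≤ k) :
    HasSum (fun n : ℕ+ => ((n : ℕ) : ℂ) ^ (-(2 * (β : ℂ))) *
        PTerm ((Real.pi * r / ((n : ℕ) : ℝ) ^ 2 : ℝ) : ℂ) β k)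
      (T0Term (Complex.I * r) β k) := by
  have hk' : (1 : ℝ) ≤ k := by exact_mod_cast hk
  have hz : riemannZeta (2 * β + 4 * k) ≠ 0 :=
    norm_pos_iff.1 (one_pos.trans_le (one_le_norm_zeta hβ hk))
  have h := ((hasSum_pnat_cpow_neg (s := 2 * β + 4 * k) (by simp; linarith)).div_const
    (riemannZeta (2 * β + 4 * k))).mul_left (T0Term (Complex.I * r) β k)
  rw [div_self hz, mul_one] at h
  exact h.congr_fun fun n => PTerm_mul_cpow r k n

/-- The exponent -(2β+4k) is weakened to -2, which decouples n from k and leaves a product majorant.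
-/
theorem norm_PTerm_mul_cpow_le {β : ℝ} (hβ : 0 ≤ β) (r : ℝ) {k : ℕ} (hk : 1 ≤ k) (n : ℕ+) :
    ‖((n : ℕ) : ℂ) ^ (-(2 * (β : ℂ))) *
        PTerm ((Real.pi * r / ((n : ℕ) : ℝ) ^ 2 : ℝ) : ℂ) β k‖
      ≤ ((n : ℕ) : ℝ) ^ (-2 : ℝ) * ‖T0Term (Complex.I * r) β k‖ := by
  have hk' : (1 : ℝ) ≤ k := by exact_mod_cast hk
  have hn : (1 : ℝ) ≤ ((n : ℕ) : ℝ) := Nat.one_le_cast.2 n.pos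
  rw [PTerm_mul_cpow, norm_mul, norm_div, Complex.norm_natCast_cpow_of_pos n.pos, mul_comm]
  refine mul_le_mul_of_nonneg_right ((div_le_self (by positivity) (one_le_norm_zeta hβ hk)).trans
    (Real.rpow_le_rpow_of_exponent_le hn ?_)) (norm_nonneg _)
  simp
  linarith

/-- The double family is absolutely summable: summing over j first gives the values of P, summing
over n first gives the terms of T₀. -/
theorem hasSum_T0_of_P {β : ℝ} (hβ : 0 ≤ β) (w : ℕ) (r : ℝ) :
    HasSum (fun n : ℕ+ => ((n : ℕ) : ℂ) ^ (-(2 * (β : ℂ))) *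
        P w ((Real.pi * r / ((n : ℕ) : ℝ) ^ 2 : ℝ) : ℂ) β) (T0 (Complex.I * r) β w) := by
  set a : ℕ+ → ℕ → ℂ := fun n j => ((n : ℕ) : ℂ) ^ (-(2 * (β : ℂ))) *
    PTerm ((Real.pi * r / ((n : ℕ) : ℝ) ^ 2 : ℝ) : ℂ) β (j + (w + 1)) with ha
  have hn : Summable fun n : ℕ+ => ((n : ℕ) : ℝ) ^ (-2 : ℝ) :=
    (Real.summable_nat_rpow.2 (by norm_num)).comp_injective PNat.coe_injective
  have hs : Summable fun p : ℕ+ × ℕ => a p.1 p.2 :=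
    Summable.of_norm_bounded (hn.mul_of_nonneg (summable_T0Term hβ w (Complex.I * r)).norm
      (fun n => by positivity) fun _ => norm_nonneg _)
      fun p => norm_PTerm_mul_cpow_le hβ r (by lia) p.1
  have h1 := hs.hasSum.prod_fiberwise fun n =>
    ((summable_PTerm hβ w ((Real.pi * r / ((n : ℕ) : ℝ) ^ 2 : ℝ) : ℂ)).hasSum.mul_left
      (((n : ℕ) : ℂ) ^ (-(2 * (β : ℂ)))))
  have h2 := ((Equiv.prodComm ℕ ℕ+).hasSum_iff.2 hs.hasSum).prod_fiberwise fun j =>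
    hasSum_PTerm_mul_cpow hβ r (k := j + (w + 1)) (by lia)
  rw [T0, h2.tsum_eq]
  refine (h1.mul_left _).congr_fun fun n => ?_
  rw [P]
  ring

theorem T0_pos_of_P_pos {β : ℝ} (hβ : 0 ≤ β) {w : ℕ} (hP : ∀ r : ℝ, 0 < r → 0 < P w r β)
    {r : ℝ} (hr : 0 < r) : 0 < T0 (Complex.I * r) β w := by
  have hpos : ∀ n : ℕ+, 0 < ((n : ℕ) : ℂ) ^ (-(2 * (β : ℂ))) *
      P w ((Real.pi * r / ((n : ℕ) : ℝ) ^ 2 : ℝ) : ℂ) β := fun n => by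
    have hn : (0 : ℝ) < ((n : ℕ) : ℝ) := by exact_mod_cast n.pos
    refine mul_pos ?_ (hP _ (by positivity))
    have h : ((n : ℕ) : ℂ) ^ (-(2 * (β : ℂ))) = ((((n : ℕ) : ℝ) ^ (-(2 * β)) : ℝ) : ℂ) := by
      rw [Complex.ofReal_cpow hn.le]
      push_cast
      rfl
    rw [h]
    exact Complex.zero_lt_real.2 (Real.rpow_pos_of_pos hn _)
  exact (hpos 1).trans_le (le_hasSum (hasSum_T0_of_P hβ w r) 1 fun n _ => (hpos n).le)

/-! ### T₀ as a Mellin density -/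

theorem hasMellin_T0 {β : ℝ} (hβ : 0 ≤ β) (w : ℕ) {s : ℂ}
    (hl : max (4 * (w : ℝ)) (1 - 2 * β) < s.re) (hr : s.re < 4 * ((w : ℝ) + 1)) :
    HasMellin (fun v : ℝ => T0 (Complex.I * ((v ^ 2)⁻¹ : ℝ)) β w) s ((-1) ^ w / b s β) := by
  obtain ⟨F, -, hF, hM⟩ := exists_lommel_average hβ w
  obtain ⟨hl1, hl2⟩ := max_lt_iff.1 hl
  have hσ : (s / ((-2 : ℝ) : ℂ)).re = -s.re / 2 := by
    rw [Complex.div_ofReal_re]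
    ring
  -- Here σ = -s/2: the strip for σ becomes 4w < Re s < 4(w+1), and σ < β-1/2 becomes Re s > 1-2β.
  have h := hM (s / ((-2 : ℝ) : ℂ)) (by rw [hσ]; linarith) (by rw [hσ]; linarith)
    (by rw [hσ]; linarith)
  have h' := (((h.comp_mul_left Real.pi_pos).const_mul ((Real.pi ^ (β - 1) : ℝ) : ℂ)).congr_Ioi
    (g := fun u => T0 (Complex.I * u) β w) fun u hu => by
      rw [T0_I_mul_eq hβ (hF _ (mul_pos Real.pi_pos hu))]
      push_cast
      rfl).comp_rpow (a := -2) (by norm_num)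
  have h'' := h'.congr_Ioi (g := fun v : ℝ => T0 (Complex.I * ((v ^ 2)⁻¹ : ℝ)) β w) fun v hv => by
    rw [Real.rpow_neg hv.le, Real.rpow_two]
  convert h'' using 1
  have hsin : Complex.sin (Real.pi * (-(s / ((-2 : ℝ) : ℂ) + 2 * w)) / 2)
      = (-1) ^ w * Complex.sin (Real.pi * s / 4) := by
    rw [← Complex.sin_antiperiodic.sub_nat_mul_eq]
    push_cast
    ring_nf
  have hpi : (Real.pi : ℂ) ≠ 0 := by exact_mod_cast Real.pi_ne_zero
  have e1 : (Real.pi : ℂ) ^ (-(2 * β + s) / 2) ≠ 0 := by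
    simp [Complex.cpow_eq_zero_iff, hpi]
  -- The powers of π balance: (β-1) + s/2 + 1 - (2β+s)/2 = 0.
  have e2 : (Real.pi : ℂ) ^ ((β : ℂ) - 1) * (Real.pi : ℂ) ^ (-(s / ((-2 : ℝ) : ℂ))) * Real.pi
      * (Real.pi : ℂ) ^ (-(2 * β + s) / 2) = 1 := by
    nth_rewrite 3 [← Complex.cpow_one (Real.pi : ℂ)]
    rw [← Complex.cpow_add _ _ hpi, ← Complex.cpow_add _ _ hpi, ← Complex.cpow_add _ _ hpi]
    push_cast
    ring_nf
    simp
  have e3 : (2 * β + s - 1 : ℂ) ≠ 0 := fun h0 => by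
    have := congrArg Complex.re h0
    simp at this
    linarith
  have e4 : (β - 1 / 2 - s / ((-2 : ℝ) : ℂ) : ℂ) = (2 * β + s - 1) / 2 := by
    push_cast
    ring
  have e5 : Complex.Gamma (1 - s / ((-2 : ℝ) : ℂ) + β) = Complex.Gamma (1 + (2 * β + s) / 2) := by
    congr 1
    push_cast
    ring
  have e7 : ((-1 : ℂ) ^ w) * (-1) ^ w = 1 := by rw [← mul_pow]; simp
  have e8 : ((|(-2 : ℝ)|⁻¹ : ℝ) : ℂ) = 1 / 2 := by norm_num
  have e9 : ((Real.pi ^ (β - 1) : ℝ) : ℂ) = (Real.pi : ℂ) ^ ((β : ℂ) - 1) := by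
    rw [Complex.ofReal_cpow Real.pi_pos.le]
    push_cast
    rfl
  rw [hsin, e4, e5, b, n0, l, e9]
  -- The sine vanishes only at multiples of 4, and none lies strictly between 4w and 4(w+1).
  have h0 : Complex.sin (Real.pi * s / 4) ≠ 0 := fun h0 => by
    obtain ⟨k, hk⟩ := Complex.sin_eq_zero_iff.1 h0
    have hs : s = ((4 * k : ℝ) : ℂ) := by
      rw [mul_div_assoc, mul_comm, mul_left_inj' hpi] at hk
      push_cast
      rw [← hk]
      ring
    rw [hs, Complex.ofReal_re] at hl1 hr
    have h1 : (w : ℤ) < k := by exact_mod_cast lt_of_mul_lt_mul_left hl1 (by norm_num)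
    have h2 : k < (w : ℤ) + 1 := by exact_mod_cast lt_of_mul_lt_mul_left hr (by norm_num)
    lia
  have e10 : Complex.Gamma (1 + (2 * β + s) / 2) ≠ 0 := by
    rw [← e5]
    refine Complex.Gamma_ne_zero_of_re_pos ?_
    have hw : (0 : ℝ) ≤ w := Nat.cast_nonneg w
    rw [Complex.add_re, Complex.sub_re, hσ, Complex.one_re, Complex.ofReal_re]
    linarith
  push_cast at e2 e8 ⊢
  rw [e8]
  field_simp
  simp only [div_neg, neg_neg, neg_div] at e2
  congr 1
  rw [sq, e7]
  linear_combination -e2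

end ZetaMellin

theorem lemma6p1 (β : ℝ) (hβ : 0 ≤ β) (w : ℕ) :
    -- the two defining series converge absolutely everywhere
    (∀ z : ℂ, Summable (fun j : ℕ => ZetaMellin.T0Term z β (j + (w + 1))) ∧
      Summable (fun j : ℕ => ZetaMellin.PTerm z β (j + (w + 1)))) ∧
    -- `T₀(i v⁻², β, 4w)` is the Mellin density of `(-1)^w / b(s, β)`
    (∀ s : ℂ, max (4 * (w : ℝ)) (1 - 2 * β) < s.re → s.re < 4 * ((w : ℝ) + 1) →
      HasMellin (fun v : ℝ => ZetaMellin.T0 (Complex.I * ((v ^ 2)⁻¹ : ℝ)) β w) s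
        ((-1) ^ w / ZetaMellin.b s β)) ∧
    -- positivity of `P_{4w}` implies that of `T₀`
    ((∀ r : ℝ, 0 < r → 0 < ZetaMellin.P w r β) →
      ∀ r : ℝ, 0 < r → 0 < ZetaMellin.T0 (Complex.I * r) β w) ∧
    -- positivity of `T₀`
    (∀ r : ℝ, 0 < r → 0 < ZetaMellin.T0 (Complex.I * r) β w) ∧
    -- `T₀` as a series in `P_{4w}`
    (∀ r : ℝ, 0 < r →
      HasSum (fun n : ℕ+ => ((n : ℕ) : ℂ) ^ (-(2 * (β : ℂ))) *
          ZetaMellin.P w ((Real.pi * r / ((n : ℕ) : ℝ) ^ 2 : ℝ) : ℂ) β)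
        (ZetaMellin.T0 (Complex.I * r) β w)) := by
  refine ⟨fun z => ⟨ZetaMellin.summable_T0Term hβ w z, ZetaMellin.summable_PTerm hβ w z⟩,
    fun s hl hr => ZetaMellin.hasMellin_T0 hβ w hl hr,
    fun hP r hr => ZetaMellin.T0_pos_of_P_pos hβ hP hr, fun r hr => ?_,
    fun r _ => ZetaMellin.hasSum_T0_of_P hβ w r⟩
  obtain ⟨F, hpos, hF, -⟩ := exists_lommel_average hβ w
  rw [ZetaMellin.T0_I_mul_eq hβ (hF _ (mul_pos Real.pi_pos hr))]
  exact Complex.zero_lt_real.2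
    (mul_pos (Real.rpow_pos_of_pos Real.pi_pos _) (hpos _ (mul_pos Real.pi_pos hr)))
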